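/- Let $n\ge 1$, $0<s<1$, and let $\Omega\subset\mathbb R^n$ be a bounded open set. Let $M$ be a Young function: $M:\mathbb R\to\mathbb R$ is even, convex, continuous, positive on $(0,\infty)$, $M(t)/t\to0$ as $t\to0$, $M(t)/t\to\infty$ as $t\to\infty$, and $M(t)=\int_0^{|t|}m(\sigma)\,d\sigma$ with $m:[0,\infty)\to[0,\infty)$ nondecreasing, right continuous, $m(t)=0$ iff $t=0$, $m(t)\to\infty$ as $t\to\infty$. No $\Delta_2$-condition is assumed. Let $\bar M(t)=\sup_{\tau\ge0}(\tau|t|-M(\tau))$ be its complementary function and $\bar M^{-1}$ the inverse of $\bar M$ on $[0,\infty)$. On $\mathbb R^{n}\times\mathbb R^n$ put $d\nu_n=\frac{dx\,dy}{|x-y|^n}$, and for $u:\mathbb R^n\to\mathbb R$ put $D^su(x,y)=\frac{u(x)-u(y)}{|x-y|^s}$. For a measure $\mu$ let $E_M(\mu)$ be the space of measurable $u$ with $\int M(u/k)\,d\mu<\infty$ for every $k>0$ (modulo equality a.e.), with the Luxemburg norm $\|u\|_{M,\mu}=\inf\{k>0:\int M(u/k)\,d\mu\le1\}$. Let $W^sE_M=\{u\in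 E_M(dx): D^su\in E_M(\nu_n)\}$ with norm $\|u\|_{s,M}=\|u\|_{M,dx}+\|D^su\|_{M,\nu_n}$, and let $W^s_0E_M(\Omega)$ be the closure of $C_c^\infty(\Omega)$ in $W^sE_M$ in norm. Let $a:\mathbb R^n\times\mathbb R^n\times\mathbb R\to\mathbb R$ be measurable in $(x,y)$ for every $\xi$ and satisfy, for a.e. $(x,y)$: $a(x,y,\cdot)$ is continuous and odd; $a(x,y,\xi)\xi>0$ for $\xi\ne0$; $|a(x,y,\xi)|\le d(x,y)+b\,\bar M^{-1}(M(c\xi))$ for all $\xi$, for some $d\in E_{\bar M}(\nu_n)$ and constants $b,c>0$; $(a(x,y,\xi)-a(x,y,\xi'))(\xi-\xi')\ge0$ for all $\xi,\xi'$; and $a(x,y,\xi)\xi\ge\theta M(c'\xi)$ for all $\xi$, for some constants $\theta,c'>0$. Put $A(x,y,t)=\int_0^ta(x,y,\tau)\,d\tau$, $\mathcal A^s(u)=\iint A(x,y,D^su)\,d\nu_n\in[0,\infty]$, and $\mathcal N^s=\{u\in W^s_0E_M(\Omega):\mathcal A^s(u)=1\}$. Then for every $u\in W^s_0E_M(\Omega)\setminus\{0\}$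 there is exactly one $r(u)>0$ with $\mathcal A^s(r(u)u)=1$. Moreover, let $\|\cdot\|$ be either of the norms $\|u\|_{s,M}$ and $\|D^su\|_{M,\nu_n}$ on $W^s_0E_M(\Omega)$. Then the map $H(u)=r(u)u$ is a homeomorphism (for the topology of $\|\cdot\|_{s,M}$) from the unit sphere $\{u\in W^s_0E_M(\Omega):\|u\|=1\}$ onto $\mathcal N^s$, its inverse is $H^{-1}(v)=v/\|v\|$, and there is $\delta>0$ such that $\delta\le\|v\|\le\delta^{-1}$ for all $v\in\mathcal N^s$. -/

import Mathlib

open MeasureTheory Set Filter Topology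
open scoped ENNReal Distributions

namespace FracOrlicz

/-! ### Young functions -/

/-- A Young function: an even, convex, continuous `M : ℝ → ℝ`, positive away from `0`, with
`M(t)/t → 0` at `0` and `M(t)/t → ∞` at `∞`, which is the primitive of a nondecreasing,
right continuous `m : [0,∞) → [0,∞)` vanishing exactly at `0` and tending to `∞`. -/
structure YoungFunction where
  toFun : ℝ → ℝ
  even' : ∀ t, toFun (-t) = toFun t
  convex' : ConvexOn ℝ univ toFun
  continuous' : Continuous toFun
  pos' : ∀ t, 0 < t → 0 < toFun t
  tendsto_zero' : Tendsto (fun t => toFun t / t) (𝓝[≠] 0) (𝓝 0)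
  tendsto_atTop' : Tendsto (fun t => toFun t / t) atTop atTop
  exists_density' : ∃ m : ℝ → ℝ, MonotoneOn m (Ici 0) ∧
    (∀ t, 0 ≤ t → ContinuousWithinAt m (Ici t) t) ∧
    (∀ t, 0 ≤ t → 0 ≤ m t) ∧ (∀ t, 0 ≤ t → (m t = 0 ↔ t = 0)) ∧
    Tendsto m atTop atTop ∧ ∀ t, toFun t = ∫ σ in (0 : ℝ)..|t|, m σ

instance : CoeFun YoungFunction (fun _ => ℝ → ℝ) := ⟨YoungFunction.toFun⟩

/-- The complementary function `M̄(t) = sup {τ|t| - M(τ) : τ ≥ 0}`. -/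
noncomputable def conj (M : ℝ → ℝ) (t : ℝ) : ℝ :=
  sSup ((fun τ => τ * |t| - M τ) '' Ici 0)

/-- The inverse on `[0,∞)` of a continuous, strictly increasing bijection `N` of `[0,∞)`,
written as `N⁻¹(y) = sup {t ≥ 0 : N(t) ≤ y}`. -/
noncomputable def invNonneg (N : ℝ → ℝ) (y : ℝ) : ℝ :=
  sSup {t | 0 ≤ t ∧ N t ≤ y}

/-! ### Orlicz classes and the Luxemburg norm -/

section Orlicz

variable {α : Type*} [MeasurableSpace α]

/-- The modular `∫ M(f) dμ`, with values in `[0,∞]`. -/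
noncomputable def modular (M : ℝ → ℝ) (μ : Measure α) (f : α → ℝ) : ℝ≥0∞ :=
  ∫⁻ x, ENNReal.ofReal (M (f x)) ∂μ

/-- Membership in `E_M(μ)`: `f` is measurable and `∫ M(f/k) dμ < ∞` for every `k > 0`. -/
def MemE (M : ℝ → ℝ) (μ : Measure α) (f : α → ℝ) : Prop :=
  AEMeasurable f μ ∧ ∀ k : ℝ, 0 < k → modular M μ (fun x => f x / k) < ∞

/-- The Luxemburg norm `inf {k > 0 : ∫ M(f/k) dμ ≤ 1}`. -/
noncomputable def luxNorm (M : ℝ → ℝ) (μ : Measure α) (f : α → ℝ) : ℝ :=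
  sInf {k | 0 < k ∧ modular M μ (fun x => f x / k) ≤ 1}

end Orlicz

/-! ### Helper facts: `E_M` is a vector space and the Luxemburg norm is a norm on it -/

namespace YoungFunction

variable (M : YoungFunction)

theorem map_zero : M 0 = 0 := by
  obtain ⟨m, -, -, -, -, -, h⟩ := M.exists_density'
  simpa using h 0

theorem nonneg (t : ℝ) : 0 ≤ M t := by
  rcases lt_trichotomy t 0 with h | h | h
  · rw [← M.even']; exact (M.pos' _ (by linarith)).le
  · rw [h, M.map_zero]
  · exact (M.pos' _ h).le

theorem pos_of_ne {t : ℝ} (ht : t ≠ 0) : 0 < M t := by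
  rcases lt_or_gt_of_ne ht with h | h
  · rw [← M.even']; exact M.pos' _ (by linarith)
  · exact M.pos' _ h

theorem map_abs (t : ℝ) : M |t| = M t := by
  rcases abs_choice t with h | h <;> rw [h]
  exact M.even' t

theorem map_mul_le {c : ℝ} (h0 : 0 ≤ c) (h1 : c ≤ 1) (t : ℝ) : M (c * t) ≤ c * M t := by
  have := M.convex'.2 (mem_univ t) (mem_univ 0) h0 (sub_nonneg.2 h1) (by ring)
  simpa [M.map_zero] using this

theorem map_combo_le {a b : ℝ} (ha : 0 ≤ a) (hb : 0 ≤ b) (hab : a + b = 1) (x y : ℝ) :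
    M (a * x + b * y) ≤ a * M x + b * M y := by
  simpa using M.convex'.2 (mem_univ x) (mem_univ y) ha hb hab

section

variable {M} {α : Type*} [MeasurableSpace α] {μ : Measure α} {f g : α → ℝ}

theorem modular_congr (h : f =ᵐ[μ] g) : modular M μ f = modular M μ g :=
  lintegral_congr_ae (by filter_upwards [h] with x hx; rw [hx])

theorem modular_neg_congr (h : ∀ x, |f x| = |g x|) : modular M μ f = modular M μ g := by
  unfold modular
  congr 1
  ext x
  rw [← M.map_abs (f x), h x, M.map_abs]

theorem modular_mul_le {c : ℝ} (h0 : 0 ≤ c) (h1 : c ≤ 1) :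
    modular M μ (fun x => c * f x) ≤ ENNReal.ofReal c * modular M μ f := by
  unfold modular
  rw [← lintegral_const_mul' _ _ ENNReal.ofReal_ne_top]
  refine lintegral_mono fun x => ?_
  rw [← ENNReal.ofReal_mul h0]
  exact ENNReal.ofReal_le_ofReal (M.map_mul_le h0 h1 _)

theorem aemeasurable_modular (hf : AEMeasurable f μ) :
    AEMeasurable (fun x => ENNReal.ofReal (M (f x))) μ :=
  ENNReal.measurable_ofReal.comp_aemeasurable
    (M.continuous'.measurable.comp_aemeasurable hf)

theorem modular_combo_le (hf : AEMeasurable f μ) {a b : ℝ} (ha : 0 ≤ a) (hb : 0 ≤ b)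
    (hab : a + b = 1) :
    modular M μ (fun x => a * f x + b * g x) ≤
      ENNReal.ofReal a * modular M μ f + ENNReal.ofReal b * modular M μ g := by
  unfold modular
  rw [← lintegral_const_mul' _ _ ENNReal.ofReal_ne_top,
    ← lintegral_const_mul' _ _ ENNReal.ofReal_ne_top,
    ← lintegral_add_left' ((aemeasurable_modular hf).const_mul _)]
  refine lintegral_mono fun x => ?_
  rw [← ENNReal.ofReal_mul ha, ← ENNReal.ofReal_mul hb,
    ← ENNReal.ofReal_add (mul_nonneg ha (M.nonneg _)) (mul_nonneg hb (M.nonneg _))]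
  exact ENNReal.ofReal_le_ofReal (M.map_combo_le ha hb hab _ _)

theorem memE_congr (h : f =ᵐ[μ] g) (hf : MemE M μ f) : MemE M μ g := by
  refine ⟨hf.1.congr h, fun k hk => ?_⟩
  rw [← modular_congr (f := fun x => f x / k)]
  · exact hf.2 k hk
  · filter_upwards [h] with x hx
    rw [hx]

theorem memE_zero : MemE M μ (fun _ => (0 : ℝ)) :=
  ⟨aemeasurable_const, fun k _ => by simp [modular, M.map_zero]⟩

theorem memE_add (hf : MemE M μ f) (hg : MemE M μ g) : MemE M μ (fun x => f x + g x) := by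
  refine ⟨hf.1.add hg.1, fun k hk => ?_⟩
  have hk2 : 0 < k / 2 := by positivity
  have h := modular_combo_le (M := M) (μ := μ) (f := fun x => f x / (k / 2))
    (g := fun x => g x / (k / 2)) (hf.1.div_const _) (a := 1 / 2) (b := 1 / 2)
    (by norm_num) (by norm_num) (by norm_num)
  have e : (fun x => (f x + g x) / k) =
      fun x => 1 / 2 * (f x / (k / 2)) + 1 / 2 * (g x / (k / 2)) := by
    ext x; field_simp
  rw [e]
  exact h.trans_lt (ENNReal.add_lt_top.2 ⟨ENNReal.mul_lt_top ENNReal.ofReal_lt_top (hf.2 _ hk2),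
    ENNReal.mul_lt_top ENNReal.ofReal_lt_top (hg.2 _ hk2)⟩)

theorem memE_smul (c : ℝ) (hf : MemE M μ f) : MemE M μ (fun x => c * f x) := by
  rcases eq_or_ne c 0 with rfl | hc
  · simpa using memE_zero (M := M) (μ := μ)
  refine ⟨hf.1.const_mul _, fun k hk => ?_⟩
  have hc' : 0 < |c| := abs_pos.2 hc
  rw [modular_neg_congr (g := fun x => f x / (k / |c|))]
  · exact hf.2 _ (by positivity)
  · intro x
    simp only [abs_div, abs_mul, abs_abs]
    field_simp

theorem luxNorm_congr (h : f =ᵐ[μ] g) : luxNorm M μ f = luxNorm M μ g := by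
  unfold luxNorm
  congr 1
  ext k
  rw [mem_ofPred_eq, mem_ofPred_eq, modular_congr (f := fun x => f x / k) (g := fun x => g x / k)]
  filter_upwards [h] with x hx
  rw [hx]

theorem luxNorm_nonneg : 0 ≤ luxNorm M μ f :=
  Real.sInf_nonneg fun _ hk => hk.1.le

theorem luxNorm_bddBelow : BddBelow {k | 0 < k ∧ modular M μ (fun x => f x / k) ≤ 1} :=
  ⟨0, fun _ hk => hk.1.le⟩

theorem luxNorm_nonempty (hf : MemE M μ f) :
    {k | 0 < k ∧ modular M μ (fun x => f x / k) ≤ 1}.Nonempty := by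
  have h1 : modular M μ f < ∞ := by simpa using hf.2 1 one_pos
  set I := (modular M μ f).toReal with hI
  have hI0 : 0 ≤ I := ENNReal.toReal_nonneg
  refine ⟨1 + I, by positivity, ?_⟩
  have h := modular_mul_le (M := M) (μ := μ) (f := f) (c := (1 + I)⁻¹) (by positivity)
    (inv_le_one_of_one_le₀ (by linarith))
  have e : (fun x => f x / (1 + I)) = fun x => (1 + I)⁻¹ * f x := by
    ext x; ring
  rw [e]
  refine h.trans ?_
  rw [← ENNReal.ofReal_toReal h1.ne, ← hI, ← ENNReal.ofReal_mul (by positivity),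
    ← ENNReal.ofReal_one]
  refine ENNReal.ofReal_le_ofReal ?_
  rw [inv_mul_le_iff₀ (by positivity)]
  linarith

theorem luxNorm_zero : luxNorm M μ (fun _ => (0 : ℝ)) = 0 := by
  have : {k : ℝ | 0 < k ∧ modular M μ (fun _ => (0 : ℝ) / k) ≤ 1} = Ioi 0 := by
    ext k
    simp [modular, M.map_zero]
  rw [luxNorm, this, csInf_Ioi]

theorem luxNorm_add_le (hf : MemE M μ f) (hg : MemE M μ g) :
    luxNorm M μ (fun x => f x + g x) ≤ luxNorm M μ f + luxNorm M μ g := by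
  have key : ∀ k ∈ {k | 0 < k ∧ modular M μ (fun x => f x / k) ≤ 1},
      ∀ l ∈ {k | 0 < k ∧ modular M μ (fun x => g x / k) ≤ 1},
      luxNorm M μ (fun x => f x + g x) ≤ k + l := by
    rintro k ⟨hk, hk'⟩ l ⟨hl, hl'⟩
    refine csInf_le luxNorm_bddBelow ⟨by positivity, ?_⟩
    have h := modular_combo_le (M := M) (μ := μ) (f := fun x => f x / k)
      (g := fun x => g x / l) (hf.1.div_const _) (a := k / (k + l)) (b := l / (k + l))
      (by positivity) (by positivity) (by field_simp)
    have e : (fun x => (f x + g x) / (k + l)) =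
        fun x => k / (k + l) * (f x / k) + l / (k + l) * (g x / l) := by
      ext x; field_simp
    rw [e]
    refine h.trans ((add_le_add (mul_le_mul_right hk' _) (mul_le_mul_right hl' _)).trans ?_)
    rw [mul_one, mul_one, ← ENNReal.ofReal_add (by positivity) (by positivity),
      ← ENNReal.ofReal_one]
    exact ENNReal.ofReal_le_ofReal (le_of_eq (by field_simp))
  have h1 : ∀ l ∈ {k | 0 < k ∧ modular M μ (fun x => g x / k) ≤ 1},
      luxNorm M μ (fun x => f x + g x) - l ≤ luxNorm M μ f := fun l hl =>
    le_csInf (luxNorm_nonempty hf) fun k hk => by linarith [key k hk l hl]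
  have h2 : luxNorm M μ (fun x => f x + g x) - luxNorm M μ f ≤ luxNorm M μ g :=
    le_csInf (luxNorm_nonempty hg) fun l hl => by linarith [h1 l hl]
  linarith

theorem luxNorm_smul_le {c : ℝ} (hc : c ≠ 0) (hf : MemE M μ f) :
    luxNorm M μ (fun x => c * f x) ≤ |c| * luxNorm M μ f := by
  have hc' : 0 < |c| := abs_pos.2 hc
  rw [mul_comm, ← div_le_iff₀ hc']
  refine le_csInf (luxNorm_nonempty hf) ?_
  rintro k ⟨hk, hk'⟩
  rw [div_le_iff₀ hc']
  refine csInf_le luxNorm_bddBelow ⟨by positivity, ?_⟩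
  rw [modular_neg_congr (g := fun x => f x / k)]
  · exact hk'
  · intro x
    simp only [abs_div, abs_mul, abs_abs]
    field_simp

theorem luxNorm_smul (c : ℝ) (hf : MemE M μ f) :
    luxNorm M μ (fun x => c * f x) = |c| * luxNorm M μ f := by
  rcases eq_or_ne c 0 with rfl | hc
  · simpa using luxNorm_zero (M := M) (μ := μ)
  refine le_antisymm (luxNorm_smul_le hc hf) ?_
  have h := luxNorm_smul_le (inv_ne_zero hc) (memE_smul c hf)
  have e : (fun x => c⁻¹ * (c * f x)) = f := by
    ext x; field_simp
  rw [e, abs_inv] at h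
  rwa [← le_inv_mul_iff₀ (abs_pos.2 hc)]

theorem ae_eq_zero_of_luxNorm (hf : MemE M μ f) (h : luxNorm M μ f = 0) : f =ᵐ[μ] 0 := by
  have h0 : modular M μ f = 0 := by
    refine le_antisymm (ENNReal.le_of_forall_pos_le_add fun ε hε _ => ?_) zero_le
    have hlt : luxNorm M μ f < min ε 1 := by
      rw [h]; exact lt_min (by exact_mod_cast hε) one_pos
    obtain ⟨k, ⟨hk, hk'⟩, hkε⟩ := exists_lt_of_csInf_lt (luxNorm_nonempty hf) hlt
    have h1 := modular_mul_le (M := M) (μ := μ) (f := fun x => f x / k) hk.le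
      (hkε.le.trans (min_le_right _ _))
    have e : (fun x => k * (f x / k)) = f := by
      ext x; field_simp
    rw [e] at h1
    calc modular M μ f ≤ ENNReal.ofReal k * 1 := h1.trans (mul_le_mul_right hk' _)
      _ ≤ ENNReal.ofReal (ε : ℝ) := by
        rw [mul_one]; exact ENNReal.ofReal_le_ofReal (hkε.le.trans (min_le_left _ _))
      _ = 0 + ε := by simp
  rw [modular, lintegral_eq_zero_iff' (aemeasurable_modular hf.1)] at h0
  filter_upwards [h0] with x hx
  by_contra hne
  have := M.pos_of_ne hne
  simp only [Pi.zero_apply, ENNReal.ofReal_eq_zero] at hx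
  linarith

end

end YoungFunction

/-! ### Hölder quotients and the fractional Orlicz-Sobolev space `W^s E_M` -/

/-- The Euclidean space `ℝⁿ`. -/
abbrev Eu (n : ℕ) := EuclideanSpace ℝ (Fin n)

/-- The measure `dν_n = dx dy / |x - y|ⁿ` on `ℝⁿ × ℝⁿ`. -/
noncomputable def nu (n : ℕ) : Measure (Eu n × Eu n) :=
  (volume : Measure (Eu n × Eu n)).withDensity fun p => ENNReal.ofReal (1 / ‖p.1 - p.2‖ ^ n)

/-- The `s`-Hölder quotient `D^s u(x,y) = (u(x) - u(y)) / |x - y|^s`. -/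
noncomputable def holderQuot {n : ℕ} (s : ℝ) (u : Eu n → ℝ) (p : Eu n × Eu n) : ℝ :=
  (u p.1 - u p.2) / ‖p.1 - p.2‖ ^ s

theorem holderQuot_congr {n : ℕ} (s : ℝ) {u v : Eu n → ℝ} (h : u =ᵐ[volume] v) :
    holderQuot s u =ᵐ[nu n] holderQuot s v := by
  have hac : nu n ≪ (volume : Measure (Eu n)).prod volume := withDensity_absolutelyContinuous _ _
  have h1 := Measure.quasiMeasurePreserving_fst (μ := (volume : Measure (Eu n)))
    (ν := (volume : Measure (Eu n))) |>.ae_eq_comp h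
  have h2 := Measure.quasiMeasurePreserving_snd (μ := (volume : Measure (Eu n)))
    (ν := (volume : Measure (Eu n))) |>.ae_eq_comp h
  filter_upwards [hac.ae_le h1, hac.ae_le h2] with p hp1 hp2
  simp only [Function.comp_apply] at hp1 hp2
  simp only [holderQuot, hp1, hp2]

/-- `W^s E_M = {u ∈ E_M(ℝⁿ) : D^s u ∈ E_M(ν_n)}`, a space of functions modulo equality almost
everywhere, as a linear subspace of the space of all measurable functions. -/
def fracSubmodule (n : ℕ) (s : ℝ) (M : YoungFunction) :
    Submodule ℝ (Eu n →ₘ[volume] ℝ) where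
  carrier := {u | MemE M volume u ∧ MemE M (nu n) (holderQuot s u)}
  zero_mem' := by
    have h : (⇑(0 : Eu n →ₘ[volume] ℝ)) =ᵐ[volume] fun _ => (0 : ℝ) := AEEqFun.coeFn_zero
    refine ⟨YoungFunction.memE_congr h.symm YoungFunction.memE_zero,
      YoungFunction.memE_congr (holderQuot_congr s h.symm) ?_⟩
    have e : holderQuot s (fun _ : Eu n => (0 : ℝ)) = fun _ => 0 := by
      ext p; simp [holderQuot]
    rw [e]
    exact YoungFunction.memE_zero
  add_mem' := by
    rintro u v ⟨hu, hu'⟩ ⟨hv, hv'⟩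
    have h : (⇑(u + v)) =ᵐ[volume] fun x => u x + v x := AEEqFun.coeFn_add u v
    refine ⟨YoungFunction.memE_congr h.symm (YoungFunction.memE_add hu hv),
      YoungFunction.memE_congr (holderQuot_congr s h.symm) ?_⟩
    have e : holderQuot s (fun x => u x + v x) =
        fun p => holderQuot s u p + holderQuot s v p := by
      ext p; simp only [holderQuot]; ring
    rw [e]
    exact YoungFunction.memE_add hu' hv'
  smul_mem' := by
    rintro c u ⟨hu, hu'⟩
    have h : (⇑(c • u)) =ᵐ[volume] fun x => c * u x := AEEqFun.coeFn_smul c u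
    refine ⟨YoungFunction.memE_congr h.symm (YoungFunction.memE_smul c hu),
      YoungFunction.memE_congr (holderQuot_congr s h.symm) ?_⟩
    have e : holderQuot s (fun x => c * u x) = fun p => c * holderQuot s u p := by
      ext p; simp only [holderQuot]; ring
    rw [e]
    exact YoungFunction.memE_smul c hu'

/-- The space `W^s E_M`, as a type. -/
def WsE (n : ℕ) (s : ℝ) (M : YoungFunction) : Type := fracSubmodule n s M

namespace WsE

variable {n : ℕ} {s : ℝ} {M : YoungFunction}

noncomputable instance : AddCommGroup (WsE n s M) := inferInstanceAs (AddCommGroup (fracSubmodule n s M))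

noncomputable instance : Module ℝ (WsE n s M) := inferInstanceAs (Module ℝ (fracSubmodule n s M))

/-- The almost everywhere class underlying an element of `W^s E_M`. -/
def toClass (u : WsE n s M) : Eu n →ₘ[volume] ℝ := u.1

/-- The quantity `‖D^s u‖_{M, ν_n}`. -/
noncomputable def gagliardo (u : WsE n s M) : ℝ := luxNorm M (nu n) (holderQuot s u.toClass)

/-- The norm `‖u‖_{s,M} = ‖u‖_M + ‖D^s u‖_{M, ν_n}`. -/
noncomputable instance : Norm (WsE n s M) :=
  ⟨fun u => luxNorm M volume u.toClass + gagliardo u⟩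

theorem norm_def (u : WsE n s M) : ‖u‖ = luxNorm M volume u.toClass + gagliardo u := rfl

theorem core : NormedSpace.Core ℝ (WsE n s M) where
  norm_nonneg u := add_nonneg YoungFunction.luxNorm_nonneg YoungFunction.luxNorm_nonneg
  norm_smul c u := by
    have h : (c • u).toClass =ᵐ[volume] fun x => c * u.toClass x :=
      AEEqFun.coeFn_smul c u.toClass
    have e : holderQuot s (fun x => c * u.toClass x) =
        fun p => c * holderQuot s u.toClass p := by
      ext p; simp only [holderQuot]; ring
    rw [norm_def, norm_def, gagliardo, gagliardo, YoungFunction.luxNorm_congr h,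
      YoungFunction.luxNorm_congr (holderQuot_congr s h), e,
      YoungFunction.luxNorm_smul (f := u.toClass) c u.2.1,
      YoungFunction.luxNorm_smul (f := holderQuot s u.toClass) c u.2.2,
      Real.norm_eq_abs, mul_add]
  norm_triangle u v := by
    have h : (u + v).toClass =ᵐ[volume] fun x => u.toClass x + v.toClass x :=
      AEEqFun.coeFn_add u.toClass v.toClass
    have e : holderQuot s (fun x => u.toClass x + v.toClass x) =
        fun p => holderQuot s u.toClass p + holderQuot s v.toClass p := by
      ext p; simp only [holderQuot]; ring
    simp only [norm_def, gagliardo]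
    rw [YoungFunction.luxNorm_congr h, YoungFunction.luxNorm_congr (holderQuot_congr s h), e]
    have h1 := YoungFunction.luxNorm_add_le u.2.1 v.2.1
    have h2 := YoungFunction.luxNorm_add_le u.2.2 v.2.2
    calc _ ≤ _ := add_le_add h1 h2
      _ = _ := add_add_add_comm _ _ _ _
  norm_eq_zero_iff u := by
    constructor
    · intro h
      have h1 : luxNorm M volume u.toClass = 0 := by
        have a1 : 0 ≤ luxNorm M volume u.toClass := YoungFunction.luxNorm_nonneg
        have a2 : 0 ≤ gagliardo u := YoungFunction.luxNorm_nonneg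
        rw [norm_def] at h
        linarith
      refine Subtype.ext (AEEqFun.ext ?_)
      exact (YoungFunction.ae_eq_zero_of_luxNorm u.2.1 h1).trans AEEqFun.coeFn_zero.symm
    · rintro rfl
      have h : (0 : WsE n s M).toClass =ᵐ[volume] fun _ => (0 : ℝ) := AEEqFun.coeFn_zero
      have e : holderQuot s (fun _ : Eu n => (0 : ℝ)) = fun _ => 0 := by
        ext p; simp [holderQuot]
      rw [norm_def, gagliardo, YoungFunction.luxNorm_congr h,
        YoungFunction.luxNorm_congr (holderQuot_congr s h), e, YoungFunction.luxNorm_zero,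
        YoungFunction.luxNorm_zero, add_zero]

noncomputable instance : NormedAddCommGroup (WsE n s M) := NormedAddCommGroup.ofCore core

noncomputable instance : NormedSpace ℝ (WsE n s M) := NormedSpace.ofCore core

end WsE

/-- `W^s_0 E_M(Ω)`: the closure in `W^s E_M`, in the norm topology, of the set of (classes of)
smooth functions with compact support in `Ω`. -/
def W0sE {n : ℕ} (s : ℝ) (M : YoungFunction) (Ω : TopologicalSpace.Opens (Eu n)) :
    Set (WsE n s M) :=
  closure {u | ∃ φ : 𝓓(Ω, ℝ), u.toClass =ᵐ[volume] φ}

/-! ### The kernel and the energy functional -/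

/-- The structural conditions on the kernel `a(x,y,ξ)` with respect to the Young function `M`:
Carathéodory, oddness, sign, growth, monotonicity and coercivity. -/
structure KernelConditions (n : ℕ) (M : YoungFunction) (a : Eu n → Eu n → ℝ → ℝ) : Prop where
  measurable : ∀ ξ, AEMeasurable (fun p : Eu n × Eu n => a p.1 p.2 ξ) volume
  continuous : ∀ᵐ p : Eu n × Eu n, Continuous (a p.1 p.2)
  odd : ∀ᵐ p : Eu n × Eu n, ∀ ξ, a p.1 p.2 (-ξ) = -a p.1 p.2 ξ
  sign : ∀ᵐ p : Eu n × Eu n, ∀ ξ, ξ ≠ 0 → 0 < a p.1 p.2 ξ * ξ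
  growth : ∃ d : Eu n × Eu n → ℝ, MemE (conj M) (nu n) d ∧ ∃ b c : ℝ, 0 < b ∧ 0 < c ∧
    ∀ᵐ p : Eu n × Eu n, ∀ ξ, |a p.1 p.2 ξ| ≤ d p + b * invNonneg (conj M) (M (c * ξ))
  monotone : ∀ᵐ p : Eu n × Eu n, ∀ ξ ξ', 0 ≤ (a p.1 p.2 ξ - a p.1 p.2 ξ') * (ξ - ξ')
  coercive : ∃ θ c : ℝ, 0 < θ ∧ 0 < c ∧
    ∀ᵐ p : Eu n × Eu n, ∀ ξ, θ * M (c * ξ) ≤ a p.1 p.2 ξ * ξ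

/-- The energy `A^s(u) = ∬ A(x,y,D^s u) dν_n`, with `A(x,y,t) = ∫₀ᵗ a(x,y,τ) dτ ≥ 0`, as an
element of `[0,∞]`. -/
noncomputable def energy {n : ℕ} {s : ℝ} {M : YoungFunction} (a : Eu n → Eu n → ℝ → ℝ)
    (u : WsE n s M) : ℝ≥0∞ :=
  ∫⁻ p, ENNReal.ofReal (∫ τ in (0 : ℝ)..holderQuot s u.toClass p, a p.1 p.2 τ) ∂(nu n)

/-- The unit sphere of `W^s_0 E_M(Ω)` for a norm `N`. -/
def unitSphere {n : ℕ} {s : ℝ} {M : YoungFunction} (Ω : TopologicalSpace.Opens (Eu n))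
    (N : WsE n s M → ℝ) : Set (WsE n s M) :=
  {u | u ∈ W0sE s M Ω ∧ N u = 1}

/-- The level set `N^s = {u ∈ W^s_0 E_M(Ω) : A^s(u) = 1}`. -/
def levelSet {n : ℕ} {s : ℝ} {M : YoungFunction} (Ω : TopologicalSpace.Opens (Eu n))
    (a : Eu n → Eu n → ℝ → ℝ) : Set (WsE n s M) :=
  {u | u ∈ W0sE s M Ω ∧ energy a u = 1}

end FracOrlicz

open FracOrlicz

/-! The energy `J(u) = ∬ A(x,y,D^s u) dν_n` is a finite, continuous, convex function on all of `W^s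
E_M` with `J(0) = 0`; the radial projection onto `{J = 1}` uses little more.

Young's inequality turns the growth condition into `A(x,y,t) ≤ M̄(d) + C M(kt)`
(`KernelConditions.primitive_le`). Since `E_M` is stable under every dilation, `J` is finite without
a Δ₂-condition, and it is bounded on a ball of the Gagliardo seminorm. A convex function bounded
above near one point is continuous, hence `continuous_realEnergy`. Coercivity gives `θ M(t/k) ≤
A(x,y,t)`, so `J ≤ 1` bounds the Gagliardo seminorm (`exists_gagliardo_le`).

On a ray, convexity and `J(0) = 0` force `J < 1` strictly before any point where `J ≤ 1`
(`lt_one_of_lt_level`). This gives uniqueness of `r(u)` and, with continuity of `J`, continuity of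
`r`; no strict convexity is needed. The Poincaré inequality `exists_norm_le_gagliardo` makes the
Gagliardo seminorm a norm on `W^s_0 E_M(Ω)` equivalent to the full one, so every nonzero ray leaves
`{J ≤ 1}` and both choices of norm are covered. -/

namespace FracOrlicz

/-! ### Young's inequality for the complementary function -/

namespace YoungFunction

variable (M : YoungFunction)

theorem map_mul_le_map_mul {c k : ℝ} (h0 : 0 ≤ c) (hk : 0 < k) (hck : c ≤ k) (t : ℝ) :
    M (c * t) ≤ M (k * t) := by
  have h1 : c / k ≤ 1 := (div_le_one hk).2 hck
  have h := M.map_mul_le (div_nonneg h0 hk.le) h1 (k * t)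
  have e : c / k * (k * t) = c * t := by field_simp
  rw [e] at h
  exact h.trans (mul_le_of_le_one_left (M.nonneg _) h1)

/-- Superlinear growth makes `τ|t| - M τ` nonpositive for large `τ`. Without this bound the real
`sSup` in `conj` would take its default value `0`. -/
theorem bddAbove_conj (t : ℝ) : BddAbove ((fun τ => τ * |t| - M τ) '' Ici 0) := by
  obtain ⟨T, hT⟩ := (eventually_atTop.1 (M.tendsto_atTop'.eventually_ge_atTop |t|))
  set R := max T 1 with hR
  have hR1 : 1 ≤ R := le_max_right _ _
  refine ⟨R * |t|, ?_⟩
  rintro _ ⟨τ, hτ, rfl⟩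
  have hτ' : 0 ≤ τ := hτ
  dsimp only
  rcases le_total τ R with h | h
  · have := M.nonneg τ
    have := mul_le_mul_of_nonneg_right h (abs_nonneg t)
    linarith
  · have hpos : 0 < τ := by linarith
    have := hT τ ((le_max_left _ _).trans h)
    rw [le_div_iff₀ hpos] at this
    have := mul_nonneg (zero_le_one.trans hR1) (abs_nonneg t)
    linarith [mul_comm τ |t|]

theorem mul_abs_le_add_conj {τ : ℝ} (hτ : 0 ≤ τ) (t : ℝ) : τ * |t| ≤ M τ + conj M t := by
  have : τ * |t| - M τ ≤ conj M t := le_csSup (M.bddAbove_conj t) ⟨τ, hτ, rfl⟩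
  linarith

theorem conj_nonneg (t : ℝ) : 0 ≤ conj M t := by
  simpa [M.map_zero] using M.mul_abs_le_add_conj le_rfl t

theorem conj_zero : conj M 0 = 0 := by
  refine le_antisymm (csSup_le (nonempty_Ici.image _) ?_) (M.conj_nonneg 0)
  rintro _ ⟨τ, -, rfl⟩
  simpa using M.nonneg τ

/-- Young's inequality holds for each `t` admissible in the supremum defining `invNonneg`, hence for
the supremum; neither continuity nor invertibility of `conj M` enters. -/
theorem mul_invNonneg_conj_le {τ y : ℝ} (hτ : 0 ≤ τ) (hy : 0 ≤ y) :
    τ * invNonneg (conj M) y ≤ M τ + y := by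
  rcases hτ.eq_or_lt with rfl | hτ'
  · simpa [M.map_zero] using hy
  rw [mul_comm, ← le_div_iff₀ hτ']
  refine csSup_le ⟨0, le_rfl, by rwa [M.conj_zero]⟩ ?_
  rintro t ⟨ht, hty⟩
  rw [le_div_iff₀ hτ']
  have := M.mul_abs_le_add_conj hτ t
  rw [abs_of_nonneg ht] at this
  linarith

end YoungFunction

/-! ### Primitives of odd monotone functions -/

theorem integral_even_of_odd {f : ℝ → ℝ} (hodd : ∀ x, f (-x) = -f x) (t : ℝ) :
    ∫ τ in (0 : ℝ)..(-t), f τ = ∫ τ in (0 : ℝ)..t, f τ := by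
  have h := intervalIntegral.integral_comp_neg (a := 0) (b := t) f
  rw [neg_zero] at h
  rw [intervalIntegral.integral_symm, ← h]
  simp [hodd]

theorem integral_abs_of_odd {f : ℝ → ℝ} (hodd : ∀ x, f (-x) = -f x) (t : ℝ) :
    ∫ τ in (0 : ℝ)..|t|, f τ = ∫ τ in (0 : ℝ)..t, f τ := by
  rcases abs_choice t with h | h <;> rw [h]
  exact integral_even_of_odd hodd t

theorem convexOn_integral_of_monotone {f : ℝ → ℝ} (hc : Continuous f) (hm : Monotone f) :
    ConvexOn ℝ univ fun t => ∫ τ in (0 : ℝ)..t, f τ := by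
  have hd : deriv (fun t => ∫ τ in (0 : ℝ)..t, f τ) = f := by
    ext t
    exact hc.deriv_integral f 0 t
  refine Monotone.convexOn_univ_of_deriv (fun t => ?_) (by rwa [hd])
  exact (intervalIntegral.integral_hasDerivAt_right (hc.intervalIntegrable _ _)
    (hc.stronglyMeasurableAtFilter _ _) hc.continuousAt).differentiableAt

theorem integral_le_mul_of_monotone {f : ℝ → ℝ} (hc : Continuous f) (hm : Monotone f)
    {t : ℝ} (ht : 0 ≤ t) : ∫ τ in (0 : ℝ)..t, f τ ≤ t * f t := by
  have h := intervalIntegral.integral_mono_on (μ := volume) ht (hc.intervalIntegrable 0 t)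
    (intervalIntegrable_const (c := f t)) (fun x hx => hm hx.2)
  simpa using h

/-- Only the half `[t/2, t]` of the interval is kept, where `f ≥ f(t/2)`. The loss is a dilation by
2 of the argument, which is harmless in a Luxemburg norm. -/
theorem half_mul_le_integral_of_monotone {f : ℝ → ℝ} (hc : Continuous f) (hm : Monotone f)
    (h0 : f 0 = 0) {t : ℝ} (ht : 0 ≤ t) : t / 2 * f (t / 2) ≤ ∫ τ in (0 : ℝ)..t, f τ := by
  have h1 := intervalIntegral.integral_mono_on (μ := volume) (a := t / 2) (b := t) (by linarith)
    (intervalIntegrable_const (c := f (t / 2))) (hc.intervalIntegrable _ _)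
    (fun x hx => hm hx.1)
  have h2 : 0 ≤ ∫ τ in (0 : ℝ)..(t / 2), f τ :=
    intervalIntegral.integral_nonneg (by linarith) fun x hx => h0 ▸ hm hx.1
  rw [← intervalIntegral.integral_add_adjacent_intervals (hc.intervalIntegrable 0 (t / 2))
    (hc.intervalIntegrable _ _)]
  rw [intervalIntegral.integral_const, smul_eq_mul] at h1
  have e : t - t / 2 = t / 2 := by ring
  rw [e] at h1
  linarith

/-! ### Radial projection onto a level set of a convex function -/

section Radial

variable {E : Type*} [NormedAddCommGroup E] [NormedSpace ℝ E]

theorem ConvexOn.map_smul_le {J : E → ℝ} (hJ : ConvexOn ℝ univ J) (h0 : J 0 = 0) {c : ℝ}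
    (hc0 : 0 ≤ c) (hc1 : c ≤ 1) (u : E) : J (c • u) ≤ c * J u := by
  have := hJ.2 (mem_univ u) (mem_univ 0) hc0 (sub_nonneg.2 hc1) (by ring)
  simpa [h0] using this

/-- Convexity with `J 0 = 0` gives `J(qu) ≤ (q/r) J(ru) ≤ q/r < 1`. -/
theorem lt_one_of_lt_level {J : E → ℝ} (hJ : ConvexOn ℝ univ J) (h0 : J 0 = 0) {u : E}
    {q r : ℝ} (hq : 0 ≤ q) (hqr : q < r) (hr : J (r • u) ≤ 1) : J (q • u) < 1 := by
  have hr0 : 0 < r := hq.trans_lt hqr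
  have h := ConvexOn.map_smul_le hJ h0 (div_nonneg hq hr0.le) ((div_le_one hr0).2 hqr.le) (r • u)
  rw [smul_smul, div_mul_cancel₀ _ hr0.ne'] at h
  have h1 : q / r < 1 := (div_lt_one hr0).2 hqr
  have h2 : q / r * J (r • u) ≤ q / r * 1 :=
    mul_le_mul_of_nonneg_left hr (div_nonneg hq hr0.le)
  linarith

theorem existsUnique_level {J : E → ℝ} (hJ : ConvexOn ℝ univ J) (h0 : J 0 = 0)
    (hc : Continuous J) {u : E} {R : ℝ} (hR0 : 0 ≤ R) (hR : 1 ≤ J (R • u)) :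
    ∃! r : ℝ, 0 < r ∧ J (r • u) = 1 := by
  have hcont : Continuous fun r : ℝ => J (r • u) := hc.comp (continuous_id.smul continuous_const)
  obtain ⟨r, hr, hr1⟩ := intermediate_value_Icc hR0 hcont.continuousOn
    (show (1 : ℝ) ∈ Icc (J ((0 : ℝ) • u)) (J (R • u)) from ⟨by simp [h0], hR⟩)
  have hpos : ∀ q : ℝ, 0 ≤ q → J (q • u) = 1 → 0 < q := fun q hq h1 => by
    refine hq.lt_of_ne ?_
    rintro rfl
    simp [h0] at h1
  refine ⟨r, ⟨hpos r hr.1 hr1, hr1⟩, ?_⟩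
  rintro q ⟨hq, hq1⟩
  rcases lt_trichotomy q r with h | h | h
  · exact absurd hq1 (lt_one_of_lt_level hJ h0 hq.le h hr1.le).ne
  · exact h
  · exact absurd hr1 (lt_one_of_lt_level hJ h0 hr.1 h hq1.le).ne

/-- For fixed `q`, whether `q` lies below or above `r x` is read off from `J(q • f x) < 1` or `> 1`,
and these are open conditions in `x`. -/
theorem continuous_level {X : Type*} [TopologicalSpace X] {J : E → ℝ}
    (hJ : ConvexOn ℝ univ J) (h0 : J 0 = 0) (hc : Continuous J) {f : X → E}
    (hf : Continuous f) {r : X → ℝ} (hr : ∀ x, 0 < r x) (hr1 : ∀ x, J (r x • f x) = 1) :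
    Continuous r := by
  refine continuous_iff_continuousAt.2 fun x => tendsto_order.2 ⟨fun q hq => ?_, fun q hq => ?_⟩
  · rcases lt_or_ge q 0 with hq0 | hq0
    · exact Eventually.of_forall fun y => hq0.trans (hr y)
    have h1 : J (q • f x) < 1 := lt_one_of_lt_level hJ h0 hq0 hq (hr1 x).le
    filter_upwards [(hc.comp (hf.const_smul q)).continuousAt.eventually_lt_const h1] with y hy
    by_contra! h
    rcases h.eq_or_lt with h | h
    · have hy1 := hr1 y
      rw [h] at hy1
      exact hy.ne hy1
    · exact (lt_one_of_lt_level hJ h0 (hr y).le h hy.le).ne (hr1 y)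
  · have hq0 : 0 ≤ q := (hr x).le.trans hq.le
    have h1 : 1 < J (q • f x) := by
      by_contra! h
      exact (lt_one_of_lt_level hJ h0 (hr x).le hq h).ne (hr1 x)
    filter_upwards [(hc.comp (hf.const_smul q)).continuousAt.eventually_const_lt h1] with y hy
    by_contra! h
    rcases h.eq_or_lt with h | h
    · have hy1 := hr1 y
      rw [← h] at hy1
      exact hy.ne hy1.symm
    · exact absurd hy (lt_one_of_lt_level hJ h0 hq0 h (hr1 y).le).not_gt

/-- The radial projection of the unit sphere of `N` in a cone `W` onto the level set `{J = 1}`,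
as a homeomorphism. -/
theorem exists_radial_homeomorph {W : Set E} (hW : ∀ (c : ℝ), ∀ u ∈ W, c • u ∈ W) {J : E → ℝ}
    (hJ : ConvexOn ℝ univ J) (h0 : J 0 = 0) (hc : Continuous J)
    (hlev : ∀ u ∈ W, u ≠ 0 → ∃! r : ℝ, 0 < r ∧ J (r • u) = 1) (N : Seminorm ℝ E)
    (hN : Continuous N) (hN0 : ∀ u ∈ W, u ≠ 0 → 0 < N u) :
    ∃ H : ↥{u | u ∈ W ∧ N u = 1} ≃ₜ ↥{u | u ∈ W ∧ J u = 1},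
      (∀ u : ↥{u | u ∈ W ∧ N u = 1}, ∃ r : ℝ, 0 < r ∧ J (r • (u : E)) = 1 ∧ (H u : E) = r • (u : E)) ∧
      ∀ v : ↥{u | u ∈ W ∧ J u = 1}, (H.symm v : E) = (N v)⁻¹ • (v : E) := by
  have hS : ∀ u : ↥{u | u ∈ W ∧ N u = 1}, (u : E) ≠ 0 := fun u hu => by
    have := u.2.2
    rw [hu, _root_.map_zero] at this
    exact zero_ne_one this
  have hL : ∀ v : ↥{u | u ∈ W ∧ J u = 1}, 0 < N v := fun v => hN0 v v.2.1 fun hv => by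
    have := v.2.2
    rw [hv, h0] at this
    exact zero_ne_one this
  choose r hr hr_uniq using fun u : ↥{u | u ∈ W ∧ N u = 1} => hlev u u.2.1 (hS u)
  have hrc : Continuous r :=
    continuous_level hJ h0 hc continuous_subtype_val (fun u => (hr u).1) fun u => (hr u).2
  have hNsmul : ∀ (c : ℝ) (u : E), 0 < c → N (c • u) = c * N u := fun c u hc => by
    rw [map_smul_eq_mul, Real.norm_of_nonneg hc.le]
  refine ⟨{ toFun := fun u => ⟨r u • (u : E), hW _ _ u.2.1, (hr u).2⟩
            invFun := fun v => ⟨(N v)⁻¹ • (v : E), hW _ _ v.2.1, ?_⟩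
            left_inv := fun u => ?_
            right_inv := fun v => ?_
            continuous_toFun := ?_
            continuous_invFun := ?_ }, fun u => ⟨r u, (hr u).1, (hr u).2, rfl⟩, fun v => rfl⟩
  · rw [hNsmul _ _ (inv_pos.2 (hL v)), inv_mul_cancel₀ (hL v).ne']
  · refine Subtype.ext ?_
    change (N (r u • (u : E)))⁻¹ • (r u • (u : E)) = u
    rw [hNsmul _ _ (hr u).1, u.2.2, mul_one, smul_smul, inv_mul_cancel₀ (hr u).1.ne', one_smul]
  · refine Subtype.ext ?_
    change r _ • ((N v)⁻¹ • (v : E)) = v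
    -- Scaling `v / N v` by `N v` returns to `v`, which has level 1; uniqueness identifies `N v`
    -- with the radius `r`.
    rw [← hr_uniq ⟨(N v)⁻¹ • (v : E), _⟩ (N v) ⟨hL v, ?_⟩, smul_smul, mul_inv_cancel₀ (hL v).ne',
      one_smul]
    change J (N v • ((N v)⁻¹ • (v : E))) = 1
    rw [smul_smul, mul_inv_cancel₀ (hL v).ne', one_smul]
    exact v.2.2
  · exact (hrc.smul continuous_subtype_val).subtype_mk _
  · exact (((hN.comp continuous_subtype_val).inv₀ fun v => (hL v).ne').smul
      continuous_subtype_val).subtype_mk _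

end Radial

end FracOrlicz

namespace FracOrlicz

/-! ### Compositions with Carathéodory functions -/

section Caratheodory

variable {α : Type*} [MeasurableSpace α]

/-- A Carathéodory function agrees off a null set with one that is continuous in the second
variable at every point and measurable in the first one. -/
theorem exists_caratheodory_mk {μ : Measure α} {f : α → ℝ → ℝ}
    (hm : ∀ ξ, AEMeasurable (fun p => f p ξ) μ) (hc : ∀ᵐ p ∂μ, Continuous (f p)) :
    ∃ g : α → ℝ → ℝ, (∀ ξ, Measurable fun p => g p ξ) ∧ (∀ p, Continuous (g p)) ∧
      ∀ᵐ p ∂μ, g p = f p := by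
  -- Only countably many null sets can be discarded, so measurable representatives are fixed at
  -- rational `ξ`; continuity recovers real `ξ` as limits.
  have hq : ∀ᵐ p ∂μ, Continuous (f p) ∧ ∀ q : ℚ, f p q = (hm q).mk _ p :=
    hc.and (ae_all_iff.2 fun q => (hm q).ae_eq_mk)
  obtain ⟨G, hG, hGm, hGp⟩ := hq.exists_measurable_mem
  classical
  refine ⟨fun p => if p ∈ G then f p else 0, fun ξ => ?_, fun p => ?_, ?_⟩
  · have hrat : ∀ q : ℚ, Measurable fun p => (if p ∈ G then f p else 0) (q : ℝ) := fun q => by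
      have e : (fun p => (if p ∈ G then f p else 0) (q : ℝ)) = G.indicator ((hm q).mk _) := by
        ext p
        by_cases hp : p ∈ G
        · simp [hp, (hGp p hp).2 q]
        · simp [hp]
      rw [e]
      exact (hm q).measurable_mk.indicator hGm
    obtain ⟨u, hu⟩ := mem_closure_iff_seq_limit.1 (Rat.denseRange_cast (𝕜 := ℝ) ξ)
    choose q hqu using hu.1
    refine measurable_of_tendsto_metrizable (fun k => hrat (q k)) (tendsto_pi_nhds.2 fun p => ?_)
    by_cases hp : p ∈ G
    · simp only [hp, if_true, hqu]
      exact (hGp p hp).1.continuousAt.tendsto.comp hu.2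
    · simp [hp]
  · dsimp only
    split_ifs with hp
    · exact (hGp p hp).1
    · exact continuous_zero
  · filter_upwards [hG] with p hp
    simp [hp]

/-- The primitive is again Carathéodory: continuous in the endpoint, measurable in `p`. It is
therefore jointly measurable and can be composed with `h`. -/
theorem aemeasurable_integral_caratheodory {μ : Measure α} {f : α → ℝ → ℝ}
    (hm : ∀ ξ, AEMeasurable (fun p => f p ξ) μ) (hc : ∀ᵐ p ∂μ, Continuous (f p))
    {h : α → ℝ} (hh : AEMeasurable h μ) :
    AEMeasurable (fun p => ∫ τ in (0 : ℝ)..h p, f p τ) μ := by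
  obtain ⟨g, hgm, hgc, hgf⟩ := exists_caratheodory_mk hm hc
  have hjoint : StronglyMeasurable (Function.uncurry fun (ξ : ℝ) (p : α) => g p ξ) :=
    stronglyMeasurable_uncurry_of_continuous_of_stronglyMeasurable hgc
      fun ξ => (hgm ξ).stronglyMeasurable
  have hprim : ∀ t : ℝ, StronglyMeasurable fun p => ∫ τ in (0 : ℝ)..t, g p τ := fun t =>
    (hjoint.integral_prod_left' (μ := volume.restrict (Ioc 0 t))).sub
      (hjoint.integral_prod_left' (μ := volume.restrict (Ioc t 0)))
  have hF : Measurable (Function.uncurry fun (t : ℝ) (p : α) => ∫ τ in (0 : ℝ)..t, g p τ) :=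
    (stronglyMeasurable_uncurry_of_continuous_of_stronglyMeasurable
      (fun p => intervalIntegral.continuous_primitive
        (fun _ _ => (hgc p).intervalIntegrable _ _) 0) hprim).measurable
  refine (hF.comp_aemeasurable (hh.prodMk aemeasurable_id)).congr ?_
  filter_upwards [hgf] with p hp
  simp [Function.uncurry, hp]

end Caratheodory

/-! ### The Luxemburg norm and the modular -/

section Luxemburg

variable {M : YoungFunction} {α : Type*} [MeasurableSpace α] {μ : Measure α} {f : α → ℝ}

theorem luxNorm_le_of_modular_le {k : ℝ} (hk : 0 < k)
    (h : modular M μ (fun x => f x / k) ≤ 1) : luxNorm M μ f ≤ k :=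
  csInf_le YoungFunction.luxNorm_bddBelow ⟨hk, h⟩

/-- The strict inequality yields an admissible `l < k`, so attainment of the infimum is not needed.
-/
theorem modular_le_one_of_luxNorm_lt (hf : MemE M μ f) {k : ℝ} (h : luxNorm M μ f < k) :
    modular M μ (fun x => f x / k) ≤ 1 := by
  obtain ⟨l, ⟨hl, hl'⟩, hlk⟩ := exists_lt_of_csInf_lt (YoungFunction.luxNorm_nonempty hf) h
  have hk : 0 < k := hl.trans hlk
  have h1 := YoungFunction.modular_mul_le (M := M) (μ := μ) (f := fun x => f x / l)
    (c := l / k) (by positivity) ((div_le_one hk).2 hlk.le)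
  have e : (fun x => l / k * (f x / l)) = fun x => f x / k := by
    ext x; field_simp
  rw [e] at h1
  refine h1.trans ((mul_le_mul_right hl' _).trans ?_)
  rw [mul_one, ← ENNReal.ofReal_one]
  exact ENNReal.ofReal_le_ofReal ((div_le_one hk).2 hlk.le)

/-- A bound of the modular of `f / k` by any constant bounds the Luxemburg norm. -/
theorem luxNorm_le_of_modular_le_ofReal {k C : ℝ} (hk : 0 < k) (hC : 1 ≤ C)
    (h : modular M μ (fun x => f x / k) ≤ ENNReal.ofReal C) : luxNorm M μ f ≤ C * k := by
  have hC0 : 0 < C := by linarith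
  refine luxNorm_le_of_modular_le (by positivity) ?_
  have h1 := YoungFunction.modular_mul_le (M := M) (μ := μ) (f := fun x => f x / k)
    (c := C⁻¹) (by positivity) (inv_le_one_of_one_le₀ hC)
  have e : (fun x => C⁻¹ * (f x / k)) = fun x => f x / (C * k) := by
    ext x; field_simp
  rw [e] at h1
  refine h1.trans ((mul_le_mul_right h _).trans ?_)
  rw [← ENNReal.ofReal_mul (by positivity), inv_mul_cancel₀ hC0.ne', ENNReal.ofReal_one]

end Luxemburg

/-! ### The Gagliardo seminorm -/

section Gagliardo

variable {n : ℕ} {s : ℝ} {M : YoungFunction}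

theorem holderQuot_add_ae (u v : WsE n s M) :
    holderQuot s (u + v).toClass =ᵐ[nu n]
      fun p => holderQuot s u.toClass p + holderQuot s v.toClass p := by
  have h : (u + v).toClass =ᵐ[volume] fun x => u.toClass x + v.toClass x :=
    AEEqFun.coeFn_add u.toClass v.toClass
  filter_upwards [holderQuot_congr s h] with p hp
  rw [hp]
  simp only [holderQuot]
  ring

theorem holderQuot_smul_ae (c : ℝ) (u : WsE n s M) :
    holderQuot s (c • u).toClass =ᵐ[nu n] fun p => c * holderQuot s u.toClass p := by
  have h : (c • u).toClass =ᵐ[volume] fun x => c * u.toClass x :=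
    AEEqFun.coeFn_smul c u.toClass
  filter_upwards [holderQuot_congr s h] with p hp
  rw [hp]
  simp only [holderQuot]
  ring

variable (n s M) in
/-- The seminorm `‖D^s u‖_{M, ν_n}` on `W^s E_M`. -/
noncomputable def gagliardoSeminorm : Seminorm ℝ (WsE n s M) :=
  Seminorm.of WsE.gagliardo
    (fun u v => by
      simp only [WsE.gagliardo]
      rw [YoungFunction.luxNorm_congr (holderQuot_add_ae u v)]
      exact YoungFunction.luxNorm_add_le u.2.2 v.2.2)
    (fun c u => by
      simp only [WsE.gagliardo]
      rw [YoungFunction.luxNorm_congr (holderQuot_smul_ae c u)]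
      exact YoungFunction.luxNorm_smul c u.2.2)

theorem gagliardoSeminorm_apply (u : WsE n s M) : gagliardoSeminorm n s M u = u.gagliardo := rfl

theorem gagliardo_le_norm (u : WsE n s M) : u.gagliardo ≤ ‖u‖ :=
  le_add_of_nonneg_left YoungFunction.luxNorm_nonneg

theorem continuous_gagliardoSeminorm : Continuous (gagliardoSeminorm n s M) :=
  Seminorm.continuous_of_le (q := normSeminorm ℝ (WsE n s M)) continuous_norm gagliardo_le_norm

end Gagliardo

/-! ### The energy functional -/

section Energy

variable {n : ℕ} {s : ℝ} {M : YoungFunction} {a : Eu n → Eu n → ℝ → ℝ}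

theorem nu_absolutelyContinuous : nu n ≪ (volume : Measure (Eu n × Eu n)) :=
  withDensity_absolutelyContinuous _ _

theorem KernelConditions.ae_monotone (ha : KernelConditions n M a) :
    ∀ᵐ p ∂(nu n), Continuous (a p.1 p.2) ∧ Monotone (a p.1 p.2) ∧
      ∀ ξ, a p.1 p.2 (-ξ) = -a p.1 p.2 ξ := by
  filter_upwards [nu_absolutelyContinuous.ae_le ha.continuous,
    nu_absolutelyContinuous.ae_le ha.monotone, nu_absolutelyContinuous.ae_le ha.odd]
    with p hc hm ho
  refine ⟨hc, fun x y hxy => ?_, ho⟩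
  rcases hxy.eq_or_lt with rfl | h
  · exact le_rfl
  · have := hm y x
    exact sub_nonneg.1 (nonneg_of_mul_nonneg_left this (sub_pos.2 h))

theorem KernelConditions.aemeasurable_primitive (ha : KernelConditions n M a) (u : WsE n s M) :
    AEMeasurable (fun p => ∫ τ in (0 : ℝ)..holderQuot s u.toClass p, a p.1 p.2 τ) (nu n) :=
  aemeasurable_integral_caratheodory (fun ξ => (ha.measurable ξ).mono_ac nu_absolutelyContinuous)
    (nu_absolutelyContinuous.ae_le ha.continuous) u.2.2.1

theorem KernelConditions.primitive_le (ha : KernelConditions n M a) :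
    ∃ d : Eu n × Eu n → ℝ, MemE (conj M) (nu n) d ∧ ∃ C k : ℝ, 0 < C ∧ 0 < k ∧
      ∀ᵐ p ∂(nu n), ∀ t, ∫ τ in (0 : ℝ)..t, a p.1 p.2 τ ≤ conj M (d p) + C * M (k * t) := by
  obtain ⟨d, hd, b, c, hb, hc, hg⟩ := ha.growth
  -- Young's inequality is used twice: for `r|d|`, contributing `M(r)`, and for `cr` against the
  -- inverse of `M̄`, contributing `2M(cr)` with factor `b/c`. The dilation `max c 1` dominates both
  -- arguments.
  refine ⟨d, hd, 1 + 2 * b / c, max c 1, by positivity, by positivity, ?_⟩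
  filter_upwards [nu_absolutelyContinuous.ae_le hg, ha.ae_monotone] with p hp ⟨hpc, hpm, hpo⟩ t
  rw [← integral_abs_of_odd hpo, ← M.map_abs (max c 1 * t), abs_mul,
    abs_of_pos (show (0 : ℝ) < max c 1 by positivity)]
  set r := |t|
  have hr : 0 ≤ r := abs_nonneg t
  have h1 := integral_le_mul_of_monotone hpc hpm hr
  have h2 : r * a p.1 p.2 r ≤ r * (|d p| + b * invNonneg (conj M) (M (c * r))) :=
    mul_le_mul_of_nonneg_left
      (((le_abs_self _).trans (hp r)).trans (by gcongr; exact le_abs_self _)) hr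
  have h3 := M.mul_abs_le_add_conj hr (d p)
  have h4 := M.mul_invNonneg_conj_le (mul_nonneg hc.le hr) (M.nonneg (c * r))
  have h5 : M (c * r) ≤ M (max c 1 * r) :=
    M.map_mul_le_map_mul hc.le (by positivity) (le_max_left _ _) r
  have h6 : M (1 * r) ≤ M (max c 1 * r) :=
    M.map_mul_le_map_mul zero_le_one (by positivity) (le_max_right _ _) r
  rw [one_mul] at h6
  have h7 : r * (b * invNonneg (conj M) (M (c * r))) ≤ 2 * b / c * M (max c 1 * r) := by
    calc r * (b * invNonneg (conj M) (M (c * r)))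
        = b / c * (c * r * invNonneg (conj M) (M (c * r))) := by field_simp
      _ ≤ b / c * (2 * M (max c 1 * r)) := by
          refine mul_le_mul_of_nonneg_left ?_ (by positivity)
          linarith
      _ = _ := by ring
  rw [mul_add] at h2
  linarith

theorem KernelConditions.le_primitive (ha : KernelConditions n M a) :
    ∃ θ k : ℝ, 0 < θ ∧ 0 < k ∧
      ∀ᵐ p ∂(nu n), ∀ t, θ * M (t / k) ≤ ∫ τ in (0 : ℝ)..t, a p.1 p.2 τ := by
  obtain ⟨θ, c, hθ, hc, hco⟩ := ha.coercive
  refine ⟨θ, 2 / c, hθ, by positivity, ?_⟩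
  filter_upwards [nu_absolutelyContinuous.ae_le hco, ha.ae_monotone] with p hp ⟨hpc, hpm, hpo⟩ t
  have h0 : a p.1 p.2 0 = 0 := by
    have := hpo 0
    rw [neg_zero] at this
    linarith
  rw [← integral_abs_of_odd hpo, ← M.map_abs, abs_div, abs_of_pos (show 0 < 2 / c by positivity)]
  have h1 := half_mul_le_integral_of_monotone hpc hpm h0 (abs_nonneg t)
  have h2 := hp (|t| / 2)
  have e : |t| / (2 / c) = c * (|t| / 2) := by field_simp
  rw [e]
  linarith [mul_comm (|t| / 2) (a p.1 p.2 (|t| / 2))]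

theorem exists_energy_le (ha : KernelConditions n M a) :
    ∃ D C k : ℝ, 0 ≤ D ∧ 0 < C ∧ 0 < k ∧ ∀ u : WsE n s M, energy a u ≤
      ENNReal.ofReal D +
        ENNReal.ofReal C * modular M (nu n) (fun p => k * holderQuot s u.toClass p) := by
  obtain ⟨d, hd, C, k, hC, hk, h⟩ := ha.primitive_le
  have hd1 : modular (conj M) (nu n) d < ∞ := by simpa using hd.2 1 one_pos
  refine ⟨(modular (conj M) (nu n) d).toReal, C, k, ENNReal.toReal_nonneg, hC, hk, fun u => ?_⟩
  have hm : AEMeasurable (fun p => ENNReal.ofReal (M (k * holderQuot s u.toClass p))) (nu n) :=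
    YoungFunction.aemeasurable_modular (u.2.2.1.const_mul k)
  rw [ENNReal.ofReal_toReal hd1.ne, modular, modular,
    ← lintegral_const_mul' _ _ ENNReal.ofReal_ne_top,
    ← lintegral_add_right' _ (hm.const_mul _)]
  refine lintegral_mono_ae ?_
  filter_upwards [h] with p hp
  rw [← ENNReal.ofReal_mul hC.le, ← ENNReal.ofReal_add (M.conj_nonneg _)
    (mul_nonneg hC.le (M.nonneg _))]
  exact ENNReal.ofReal_le_ofReal (hp _)

/-- The dilation `k` in the upper bound is arbitrary, so membership in `E_M`, not just one finite
modular, is what counts. -/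
theorem energy_lt_top (ha : KernelConditions n M a) (u : WsE n s M) : energy a u < ∞ := by
  obtain ⟨D, C, k, -, -, -, h⟩ := exists_energy_le (s := s) ha
  refine (h u).trans_lt (ENNReal.add_lt_top.2 ⟨ENNReal.ofReal_lt_top,
    ENNReal.mul_lt_top ENNReal.ofReal_lt_top ?_⟩)
  have hm := (YoungFunction.memE_smul k u.2.2).2 1 one_pos
  simp only [div_one] at hm
  exact hm

/-- The energy as a real number. -/
noncomputable def realEnergy (a : Eu n → Eu n → ℝ → ℝ) (u : WsE n s M) : ℝ := (energy a u).toReal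

/-- The default `∞.toReal = 0` differs from 1, so finiteness is not required. -/
theorem realEnergy_eq_one_iff {u : WsE n s M} : realEnergy a u = 1 ↔ energy a u = 1 := by
  simp [realEnergy, ENNReal.toReal_eq_one_iff]

theorem energy_zero : energy a (0 : WsE n s M) = 0 := by
  have h := holderQuot_smul_ae (0 : ℝ) (0 : WsE n s M)
  rw [zero_smul] at h
  rw [energy, lintegral_congr_ae (g := fun _ => 0), lintegral_zero]
  filter_upwards [h] with p hp
  rw [hp, zero_mul, intervalIntegral.integral_same, ENNReal.ofReal_zero]

theorem realEnergy_zero : realEnergy a (0 : WsE n s M) = 0 := by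
  simp [realEnergy, energy_zero]

theorem convexOn_realEnergy (ha : KernelConditions n M a) :
    ConvexOn ℝ univ (realEnergy a : WsE n s M → ℝ) := by
  refine ⟨convex_univ, fun u _ v _ x y hx hy hxy => ?_⟩
  have key : energy a (x • u + y • v) ≤
      ENNReal.ofReal x * energy a u + ENNReal.ofReal y * energy a v := by
    unfold energy
    rw [← lintegral_const_mul' _ _ ENNReal.ofReal_ne_top,
      ← lintegral_const_mul' _ _ ENNReal.ofReal_ne_top,
      ← lintegral_add_left' ((ha.aemeasurable_primitive u).ennreal_ofReal.const_mul _)]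
    refine lintegral_mono_ae ?_
    filter_upwards [ha.ae_monotone, holderQuot_add_ae (x • u) (y • v), holderQuot_smul_ae x u,
      holderQuot_smul_ae y v] with p ⟨hpc, hpm, hpo⟩ h1 h2 h3
    rw [h1, h2, h3, ← ENNReal.ofReal_mul hx, ← ENNReal.ofReal_mul hy]
    refine le_trans (ENNReal.ofReal_le_ofReal ?_) ENNReal.ofReal_add_le
    exact (convexOn_integral_of_monotone hpc hpm).2 (mem_univ _) (mem_univ _) hx hy hxy
  have hu := (energy_lt_top ha u).ne
  have hv := (energy_lt_top ha v).ne
  have hxu : ENNReal.ofReal x * energy a u ≠ ∞ := ENNReal.mul_ne_top ENNReal.ofReal_ne_top hu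
  have hyv : ENNReal.ofReal y * energy a v ≠ ∞ := ENNReal.mul_ne_top ENNReal.ofReal_ne_top hv
  have h := ENNReal.toReal_mono (ENNReal.add_ne_top.2 ⟨hxu, hyv⟩) key
  rwa [ENNReal.toReal_add hxu hyv, ENNReal.toReal_mul, ENNReal.toReal_mul,
    ENNReal.toReal_ofReal hx, ENNReal.toReal_ofReal hy] at h

theorem exists_realEnergy_le (ha : KernelConditions n M a) :
    ∃ ρ K : ℝ, 0 < ρ ∧ 0 < K ∧ ∀ u : WsE n s M, u.gagliardo < ρ → realEnergy a u ≤ K := by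
  obtain ⟨D, C, k, hD, hC, hk, h⟩ := exists_energy_le (s := s) ha
  refine ⟨k⁻¹, D + C, by positivity, by positivity, fun u hu => ?_⟩
  have h1 := modular_le_one_of_luxNorm_lt u.2.2 hu
  have e : (fun p => holderQuot s u.toClass p / k⁻¹) = fun p => k * holderQuot s u.toClass p := by
    ext p; rw [div_inv_eq_mul, mul_comm]
  have h2 : modular M (nu n) (fun p => k * holderQuot s u.toClass p) ≤ 1 := by
    rw [← e]; exact h1
  refine ENNReal.toReal_le_of_le_ofReal (by positivity) ((h u).trans ?_)
  rw [ENNReal.ofReal_add hD hC.le]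
  gcongr
  exact (mul_le_mul_right h2 _).trans_eq (mul_one _)

theorem continuous_realEnergy (ha : KernelConditions n M a) :
    Continuous (realEnergy a : WsE n s M → ℝ) := by
  obtain ⟨ρ, K, hρ, -, h⟩ := exists_realEnergy_le (s := s) ha
  rw [← continuousOn_univ]
  -- For a convex function, boundedness above near the single point `0` implies continuity
  -- everywhere.
  refine (((convexOn_realEnergy ha).continuousOn_tfae isOpen_univ univ_nonempty).out 3 1 :
    (∃ x₀ ∈ univ, (𝓝 x₀).IsBoundedUnder (· ≤ ·) (realEnergy a)) ↔
      ContinuousOn (realEnergy a) univ).1 ⟨0, mem_univ _, K, ?_⟩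
  rw [eventually_map]
  have h0 : gagliardoSeminorm n s M 0 < ρ := by rwa [_root_.map_zero]
  filter_upwards [continuous_gagliardoSeminorm.continuousAt.eventually_lt_const h0] with u hu
  exact h u hu

/-- The energy is bounded below in terms of the Gagliardo seminorm. -/
theorem exists_gagliardo_le (ha : KernelConditions n M a) :
    ∃ C : ℝ, 0 < C ∧ ∀ u : WsE n s M, realEnergy a u ≤ 1 → u.gagliardo ≤ C := by
  obtain ⟨θ, k, hθ, hk, h⟩ := ha.le_primitive
  refine ⟨max θ⁻¹ 1 * k, by positivity, fun u hu => ?_⟩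
  refine luxNorm_le_of_modular_le_ofReal hk (le_max_right _ _) ?_
  have h1 : ENNReal.ofReal θ * modular M (nu n) (fun p => holderQuot s u.toClass p / k) ≤ 1 := by
    calc _ ≤ energy a u := by
          rw [modular, ← lintegral_const_mul' _ _ ENNReal.ofReal_ne_top]
          refine lintegral_mono_ae ?_
          filter_upwards [h] with p hp
          rw [← ENNReal.ofReal_mul hθ.le]
          exact ENNReal.ofReal_le_ofReal (hp _)
      _ ≤ 1 := by
          rw [← ENNReal.ofReal_toReal (energy_lt_top ha u).ne, ← ENNReal.ofReal_one]
          exact ENNReal.ofReal_le_ofReal hu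
  calc modular M (nu n) (fun p => holderQuot s u.toClass p / k)
      = ENNReal.ofReal θ⁻¹ * (ENNReal.ofReal θ *
          modular M (nu n) (fun p => holderQuot s u.toClass p / k)) := by
        rw [← mul_assoc, ← ENNReal.ofReal_mul (by positivity), inv_mul_cancel₀ hθ.ne',
          ENNReal.ofReal_one, one_mul]
    _ ≤ ENNReal.ofReal θ⁻¹ * 1 := mul_le_mul_right h1 _
    _ ≤ _ := by
        rw [mul_one]
        exact ENNReal.ofReal_le_ofReal (le_max_left _ _)

/-- Functions of energy `1` are bounded away from `0` in the Gagliardo seminorm. -/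
theorem exists_le_gagliardo (ha : KernelConditions n M a) :
    ∃ δ : ℝ, 0 < δ ∧ ∀ u : WsE n s M, realEnergy a u = 1 → δ ≤ u.gagliardo := by
  obtain ⟨ρ, K, hρ, hK, h⟩ := exists_realEnergy_le (s := s) ha
  -- Put `L = max K 1 + 1`. If `u` had seminorm below `ρ / L`, then `J(Lu) ≤ K`, and convexity would
  -- give `1 = J(u) ≤ K / L < 1`.
  have hL : 0 < max K 1 + 1 := by positivity
  refine ⟨ρ / (max K 1 + 1), by positivity, fun u hu => ?_⟩
  by_contra! hlt
  rw [lt_div_iff₀ hL] at hlt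
  have h1 : realEnergy a ((max K 1 + 1) • u) ≤ K := by
    refine h _ ?_
    rw [← gagliardoSeminorm_apply, map_smul_eq_mul, Real.norm_of_nonneg hL.le,
      gagliardoSeminorm_apply, mul_comm]
    exact hlt
  have h2 := ConvexOn.map_smul_le (convexOn_realEnergy ha) realEnergy_zero
    (inv_nonneg.2 hL.le) (inv_le_one_of_one_le₀ (by linarith [le_max_right K 1]))
    ((max K 1 + 1) • u)
  rw [smul_smul, inv_mul_cancel₀ hL.ne', one_smul, hu, ← div_eq_inv_mul, le_div_iff₀ hL] at h2
  linarith [le_max_left K 1]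

end Energy

end FracOrlicz

namespace FracOrlicz

/-! ### The Poincaré inequality -/

section Poincare

variable {n : ℕ} {s : ℝ} {M : YoungFunction}

theorem YoungFunction.map_le_map_of_abs_le {x y : ℝ} (h : |x| ≤ |y|) : M x ≤ M y := by
  rcases eq_or_ne y 0 with rfl | hy
  · rw [abs_zero, abs_nonpos_iff] at h
    rw [h]
  have hy' : 0 < |y| := abs_pos.2 hy
  have h1 := M.map_mul_le_map_mul (abs_nonneg x) hy' h 1
  rwa [mul_one, mul_one, M.map_abs, M.map_abs] at h1

/-- The density of `nu n` is at least `1 / L ^ n` on `S`. Points of the diagonal are excluded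
because there `1 / 0` evaluates to `0`. -/
theorem smul_restrict_le_nu {L : ℝ} {S : Set (Eu n × Eu n)} (hS : MeasurableSet S)
    (h : ∀ p ∈ S, 0 < ‖p.1 - p.2‖ ∧ ‖p.1 - p.2‖ ≤ L) :
    ENNReal.ofReal (1 / L ^ n) • (volume.restrict S) ≤ nu n := by
  refine le_trans ?_ (Measure.restrict_le_self (s := S))
  rw [nu, restrict_withDensity hS, ← withDensity_const]
  refine withDensity_mono ?_
  filter_upwards [ae_restrict_mem hS] with p hp
  obtain ⟨h1, h2⟩ := h p hp
  exact ENNReal.ofReal_le_ofReal (by gcongr)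

theorem exists_norm_eq (hn : 1 ≤ n) {R : ℝ} (hR : 0 ≤ R) : ∃ y : Eu n, ‖y‖ = R := by
  refine ⟨EuclideanSpace.single ⟨0, hn⟩ R, ?_⟩
  rw [PiLp.norm_single, Real.norm_of_nonneg hR]

/-- Modular Poincaré inequality for continuous functions vanishing off a bounded set. -/
theorem exists_modular_poincare (hn : 1 ≤ n) (hs : 0 < s) (M : YoungFunction) {Ω : Set (Eu n)}
    (hΩ : Bornology.IsBounded Ω) :
    ∃ L κ : ℝ, 0 < L ∧ 0 < κ ∧ ∀ f : Eu n → ℝ, Measurable f → (∀ x ∉ Ω, f x = 0) → ∀ k : ℝ, 0 < k →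
      ENNReal.ofReal κ * modular M volume (fun x => f x / (L * k)) ≤
        modular M (nu n) (fun p => holderQuot s f p / k) := by
  obtain ⟨R, hR, hΩR⟩ := hΩ.subset_ball_lt 0 0
  -- The unit ball around `y` misses `ball 0 R ⊇ Ω`. For `q` in it, `f q = 0`, so the Hölder
  -- quotient at `(x, q)` is `f x / |x - q|^s`, with `|x - q| ≤ 2R + 2` for `x` in `ball 0 R`.
  obtain ⟨y, hy⟩ := exists_norm_eq hn (show 0 ≤ R + 1 by positivity)
  have hB0 : 0 < volume (Metric.ball y (1 : ℝ)) := Metric.measure_ball_pos _ _ one_pos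
  have hBt : volume (Metric.ball y (1 : ℝ)) < ∞ := measure_ball_lt_top
  have hSm : MeasurableSet (Metric.ball (0 : Eu n) R ×ˢ Metric.ball y (1 : ℝ)) :=
    measurableSet_ball.prod measurableSet_ball
  have hS : ∀ p ∈ Metric.ball (0 : Eu n) R ×ˢ Metric.ball y (1 : ℝ),
      p.2 ∉ Ω ∧ 0 < ‖p.1 - p.2‖ ∧ ‖p.1 - p.2‖ ≤ 2 * R + 2 := by
    rintro ⟨p, q⟩ ⟨hp, hq⟩
    dsimp only at hp hq ⊢
    rw [mem_ball_zero_iff] at hp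
    rw [mem_ball_iff_norm] at hq
    have h1 : R < ‖q‖ := by
      have h := norm_sub_le q (q - y)
      rw [sub_sub_cancel, hy] at h
      linarith
    have h2 : ‖q‖ < R + 2 := by
      have h := norm_add_le (q - y) y
      rw [sub_add_cancel, hy] at h
      linarith
    refine ⟨fun hqΩ => ?_, ?_, ?_⟩
    · have := hΩR hqΩ
      rw [mem_ball_zero_iff] at this
      linarith
    · have := norm_sub_norm_le q p
      rw [norm_sub_rev] at this
      linarith
    · have := norm_sub_le p q
      linarith
  refine ⟨(2 * R + 2) ^ s, 1 / (2 * R + 2) ^ n * (volume (Metric.ball y (1 : ℝ))).toReal,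
    by positivity, mul_pos (by positivity) (ENNReal.toReal_pos hB0.ne' hBt.ne),
    fun f hf hf0 k hk => ?_⟩
  -- Here `L` is the distance bound itself; the `L` of the statement is its power `L ^ s`.
  set L : ℝ := 2 * R + 2
  have hL : 0 < L := by positivity
  have hg : Measurable fun x => ENNReal.ofReal (M (f x / (L ^ s * k))) :=
    (M.continuous'.measurable.comp (hf.div_const _)).ennreal_ofReal
  have hball : modular M volume (fun x => f x / (L ^ s * k)) =
      ∫⁻ x in Metric.ball (0 : Eu n) R, ENNReal.ofReal (M (f x / (L ^ s * k))) := by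
    rw [modular, setLIntegral_eq_of_support_subset]
    intro x hx
    by_contra h
    have : f x = 0 := hf0 x fun hxΩ => h (hΩR hxΩ)
    simp [this, M.map_zero] at hx
  calc ENNReal.ofReal (1 / L ^ n * (volume (Metric.ball y (1 : ℝ))).toReal) *
        modular M volume (fun x => f x / (L ^ s * k))
      = ∫⁻ p, ENNReal.ofReal (M (f p.1 / (L ^ s * k)))
          ∂(ENNReal.ofReal (1 / L ^ n) • (volume.restrict
            (Metric.ball (0 : Eu n) R ×ˢ Metric.ball y (1 : ℝ)))) := by
        rw [lintegral_smul_measure, Measure.volume_eq_prod, ← Measure.prod_restrict,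
          ENNReal.ofReal_mul (by positivity), ENNReal.ofReal_toReal hBt.ne, hball,
          lintegral_prod (fun p : Eu n × Eu n => ENNReal.ofReal (M (f p.1 / (L ^ s * k))))
            (hg.comp measurable_fst).aemeasurable]
        simp only [lintegral_const, Measure.restrict_apply_univ]
        rw [lintegral_mul_const _ hg, smul_eq_mul]
        ring
    _ ≤ ∫⁻ p, ENNReal.ofReal (M (holderQuot s f p / k))
          ∂(ENNReal.ofReal (1 / L ^ n) • (volume.restrict
            (Metric.ball (0 : Eu n) R ×ˢ Metric.ball y (1 : ℝ)))) := by
        rw [lintegral_smul_measure, lintegral_smul_measure]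
        gcongr ?_ • ?_
        refine setLIntegral_mono_ae' hSm (Eventually.of_forall fun p hp => ?_)
        obtain ⟨h1, h2, h3⟩ := hS p hp
        refine ENNReal.ofReal_le_ofReal (YoungFunction.map_le_map_of_abs_le ?_)
        rw [holderQuot, hf0 _ h1, sub_zero, div_div, abs_div, abs_div]
        have h4 : 0 < ‖p.1 - p.2‖ ^ s := Real.rpow_pos_of_pos h2 s
        rw [abs_of_pos (by positivity : 0 < L ^ s * k),
          abs_of_pos (by positivity : 0 < ‖p.1 - p.2‖ ^ s * k)]
        gcongr
    _ ≤ _ := lintegral_mono' (smul_restrict_le_nu hSm fun p hp => (hS p hp).2) le_rfl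

theorem exists_poincare_testFunction (hn : 1 ≤ n) (hs : 0 < s) (M : YoungFunction)
    {Ω : TopologicalSpace.Opens (Eu n)} (hΩ : Bornology.IsBounded (Ω : Set (Eu n))) :
    ∃ C : ℝ, 0 < C ∧ ∀ u : WsE n s M, (∃ φ : 𝓓(Ω, ℝ), u.toClass =ᵐ[volume] φ) →
      luxNorm M volume u.toClass ≤ C * u.gagliardo := by
  obtain ⟨L, κ, hL, hκ, h⟩ := exists_modular_poincare hn hs M hΩ
  refine ⟨max κ⁻¹ 1 * L, by positivity, ?_⟩
  rintro u ⟨φ, hφ⟩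
  rw [← div_le_iff₀' (by positivity)]
  -- Any `k` above the seminorm has modular at most 1, to which the modular inequality applies; `k`
  -- then decreases to the seminorm.
  refine le_of_forall_gt_imp_ge_of_dense fun k hk => ?_
  have hk0 : 0 < k := (YoungFunction.luxNorm_nonneg (M := M)).trans_lt hk
  rw [div_le_iff₀' (by positivity), mul_assoc, YoungFunction.luxNorm_congr hφ]
  refine luxNorm_le_of_modular_le_ofReal (by positivity) (le_max_right _ _) ?_
  have h1 := modular_le_one_of_luxNorm_lt u.2.2 hk
  have h2 := h φ φ.continuous.measurable
    (fun x hx => image_eq_zero_of_notMem_tsupport fun hx' => hx (φ.tsupport_subset hx')) k hk0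
  have e : modular M (nu n) (fun p => holderQuot s φ p / k) ≤ 1 := by
    refine le_of_eq_of_le (YoungFunction.modular_congr ?_) h1
    filter_upwards [holderQuot_congr s hφ] with p hp
    rw [← hp]
    rfl
  calc modular M volume (fun x => φ x / (L * k))
      = ENNReal.ofReal κ⁻¹ * (ENNReal.ofReal κ * modular M volume (fun x => φ x / (L * k))) := by
        rw [← mul_assoc, ← ENNReal.ofReal_mul (by positivity), inv_mul_cancel₀ hκ.ne',
          ENNReal.ofReal_one, one_mul]
    _ ≤ ENNReal.ofReal κ⁻¹ * 1 := mul_le_mul_right (h2.trans e) _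
    _ ≤ _ := by
        rw [mul_one]
        exact ENNReal.ofReal_le_ofReal (le_max_left _ _)

/-- Poincaré inequality on `W^s_0 E_M(Ω)`. -/
theorem exists_norm_le_gagliardo (hn : 1 ≤ n) (hs : 0 < s) (M : YoungFunction)
    {Ω : TopologicalSpace.Opens (Eu n)} (hΩ : Bornology.IsBounded (Ω : Set (Eu n))) :
    ∃ C : ℝ, 0 < C ∧ ∀ u ∈ W0sE s M Ω, ‖u‖ ≤ C * u.gagliardo := by
  obtain ⟨C, hC, h⟩ := exists_poincare_testFunction hn hs M hΩ
  refine ⟨C + 1, by positivity, ?_⟩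
  -- Both sides are norm-continuous, so the estimate passes from test functions to their closure.
  -- The extra 1 in `C + 1` accounts for the Gagliardo part of the norm.
  have hcl : IsClosed {u : WsE n s M | ‖u‖ ≤ (C + 1) * gagliardoSeminorm n s M u} :=
    isClosed_le continuous_norm (continuous_const.mul continuous_gagliardoSeminorm)
  refine fun u hu => closure_minimal (fun v hv => ?_) hcl hu
  rw [mem_ofPred_eq, gagliardoSeminorm_apply, WsE.norm_def]
  linarith [h v hv]

theorem smul_mem_W0sE {Ω : TopologicalSpace.Opens (Eu n)} (c : ℝ) {u : WsE n s M}
    (hu : u ∈ W0sE s M Ω) : c • u ∈ W0sE s M Ω := by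
  refine map_mem_closure (continuous_const_smul c) hu ?_
  rintro v ⟨φ, hφ⟩
  refine ⟨c • φ, ?_⟩
  have h : (c • v).toClass =ᵐ[volume] fun x => c * v.toClass x := AEEqFun.coeFn_smul c v.toClass
  filter_upwards [h, hφ] with x hx hx'
  rw [hx, hx']
  rfl

end Poincare

/-! ### Rays in `W^s_0 E_M(Ω)` -/

section Rays

variable {n : ℕ} {s : ℝ} {M : YoungFunction} {a : Eu n → Eu n → ℝ → ℝ}
  {Ω : TopologicalSpace.Opens (Eu n)}

theorem gagliardo_pos (hn : 1 ≤ n) (hs : 0 < s) (hΩ : Bornology.IsBounded (Ω : Set (Eu n)))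
    {u : WsE n s M} (hu : u ∈ W0sE s M Ω) (hu0 : u ≠ 0) : 0 < u.gagliardo := by
  obtain ⟨C, hC, h⟩ := exists_norm_le_gagliardo hn hs M hΩ
  exact pos_of_mul_pos_right ((norm_pos_iff.2 hu0).trans_le (h u hu)) hC.le

theorem existsUnique_realEnergy_smul_eq_one (ha : KernelConditions n M a) {u : WsE n s M}
    (hu : 0 < u.gagliardo) : ∃! r : ℝ, 0 < r ∧ realEnergy a (r • u) = 1 := by
  obtain ⟨C, hC, h⟩ := exists_gagliardo_le (s := s) ha
  -- At this radius the seminorm equals `C + 1 > C`, so the energy must exceed 1.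
  have hR : 0 < (C + 1) / u.gagliardo := by positivity
  refine existsUnique_level (convexOn_realEnergy ha) realEnergy_zero (continuous_realEnergy ha)
    hR.le ?_
  by_contra! hlt
  have h1 := h _ hlt.le
  rw [← gagliardoSeminorm_apply, map_smul_eq_mul, Real.norm_of_nonneg hR.le,
    gagliardoSeminorm_apply, div_mul_cancel₀ _ hu.ne'] at h1
  linarith

theorem exists_energy_homeomorph (ha : KernelConditions n M a)
    (hpos : ∀ u ∈ W0sE s M Ω, u ≠ 0 → 0 < u.gagliardo) (q : Seminorm ℝ (WsE n s M))
    (hq : Continuous q) (hq0 : ∀ u ∈ W0sE s M Ω, u ≠ 0 → 0 < q u) :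
    ∃ H : ↥(unitSphere Ω q) ≃ₜ ↥(levelSet Ω a : Set (WsE n s M)),
      (∀ u : ↥(unitSphere Ω q), ∃ r : ℝ, 0 < r ∧ energy a (r • (u : WsE n s M)) = 1 ∧
        (H u : WsE n s M) = r • (u : WsE n s M)) ∧
      ∀ v : ↥(levelSet Ω a), (H.symm v : WsE n s M) = (q v)⁻¹ • (v : WsE n s M) := by
  have h := exists_radial_homeomorph (W := W0sE s M Ω) (fun c u hu => smul_mem_W0sE c hu)
    (convexOn_realEnergy ha) realEnergy_zero (continuous_realEnergy ha)
    (fun u hu hu0 => existsUnique_realEnergy_smul_eq_one ha (hpos u hu hu0)) q hq hq0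
  have e : (levelSet Ω a : Set (WsE n s M)) = {u | u ∈ W0sE s M Ω ∧ realEnergy a u = 1} := by
    simp only [realEnergy_eq_one_iff]
    rfl
  rw [e]
  simp only [← realEnergy_eq_one_iff]
  exact h

end Rays

end FracOrlicz

/-! ### The main theorem -/

open FracOrlicz

theorem propositionH (n : ℕ) (hn : 1 ≤ n) (s : ℝ) (hs0 : 0 < s) (hs1 : s < 1)
    (M : YoungFunction) (Ω : TopologicalSpace.Opens (Eu n))
    (hΩ : Bornology.IsBounded (Ω : Set (Eu n)))
    (a : Eu n → Eu n → ℝ → ℝ) (ha : KernelConditions n M a) :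
    (∀ u ∈ W0sE s M Ω, u ≠ 0 → ∃! r : ℝ, 0 < r ∧ energy a (r • u) = 1) ∧
    ∀ N : WsE n s M → ℝ, ((∀ u, N u = ‖u‖) ∨ (∀ u, N u = WsE.gagliardo u)) →
      (∃ H : ↥(unitSphere Ω N) ≃ₜ ↥(levelSet Ω a : Set (WsE n s M)),
        (∀ u : ↥(unitSphere Ω N), ∃ r : ℝ, 0 < r ∧ energy a (r • (u : WsE n s M)) = 1 ∧
          (H u : WsE n s M) = r • (u : WsE n s M)) ∧
        (∀ v : ↥(levelSet Ω a), (H.symm v : WsE n s M) = (N v)⁻¹ • (v : WsE n s M))) ∧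
      ∃ δ : ℝ, 0 < δ ∧ ∀ v ∈ (levelSet Ω a : Set (WsE n s M)), δ ≤ N v ∧ N v ≤ δ⁻¹ := by
  have hpos : ∀ u ∈ W0sE s M Ω, u ≠ 0 → 0 < u.gagliardo :=
    fun u hu hu0 => gagliardo_pos hn hs0 hΩ hu hu0
  refine ⟨fun u hu hu0 => ?_, fun N hN => ⟨?_, ?_⟩⟩
  · simpa only [realEnergy_eq_one_iff] using
      existsUnique_realEnergy_smul_eq_one ha (hpos u hu hu0)
  · rcases hN with hN | hN
    · obtain rfl : N = normSeminorm ℝ (WsE n s M) := funext hN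
      exact exists_energy_homeomorph ha hpos _ continuous_norm fun u _ hu0 => norm_pos_iff.2 hu0
    · obtain rfl : N = gagliardoSeminorm n s M := funext hN
      exact exists_energy_homeomorph ha hpos _ continuous_gagliardoSeminorm hpos
  · obtain ⟨δ, hδ, hlow⟩ := exists_le_gagliardo (s := s) ha
    obtain ⟨C, hC, hup⟩ := exists_gagliardo_le (s := s) ha
    obtain ⟨P, hP, hpoin⟩ := exists_norm_le_gagliardo hn hs0 M hΩ
    -- Either norm lies between the Gagliardo seminorm and the full norm, so the lower bound is
    -- needed only for the former and the upper bound only for the latter.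
    have hNle : ∀ v, v.gagliardo ≤ N v ∧ N v ≤ ‖v‖ := fun v => by
      rcases hN with hN | hN <;> rw [hN v]
      · exact ⟨gagliardo_le_norm v, le_rfl⟩
      · exact ⟨le_rfl, gagliardo_le_norm v⟩
    refine ⟨min δ (P * C)⁻¹, by positivity, ?_⟩
    rintro v ⟨hv, hv1⟩
    rw [← realEnergy_eq_one_iff] at hv1
    refine ⟨(min_le_left _ _).trans ((hlow v hv1).trans (hNle v).1), ?_⟩
    calc N v ≤ ‖v‖ := (hNle v).2
      _ ≤ P * v.gagliardo := hpoin v hv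
      _ ≤ P * C := mul_le_mul_of_nonneg_left (hup v hv1.le) hP.le
      _ = ((P * C)⁻¹)⁻¹ := (inv_inv _).symm
      _ ≤ (min δ (P * C)⁻¹)⁻¹ := inv_anti₀ (by positivity) (min_le_right _ _)
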